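/- Let $\Omega$ and $N$ be finite sets of objects and of buyers. Let $v_{ij}\in\mathbb Z_{\ge 0}$ be the value that buyer $j\in N$ has per unit of object $i\in\Omega$. Together with demands $d\in\mathbb Z_{\ge 0}^N$ and supplies $b\in\mathbb Z_{\ge 0}^\Omega$ this defines a market in which buyer $j$ has the truncated additive valuation $$v_j(y)=\max\Big\{\sum_{i\in\Omega} v_{ij}y'_i \;:\; y'\in\mathbb Z_{\ge 0}^{\Omega},\ y'\le y,\ \sum_{i\in\Omega} y'_i\le d_j\Big\},\qquad y\in\mathbb Z_{\ge 0}^\Omega.$$ For prices $p\in\mathbb R_{\ge 0}^\Omega$ the preferred bundles of buyer $j$ are the maximizers of $\sum_{i\in\Omega}(v_{ij}-p(i))\,y_i$ over all $y\in\mathbb Z_{\ge 0}^\Omega$ with $\sum_{i\in\Omega} y_i\le d_j$ and $y_i\le b_i$ for all $i\in\Omega$ (on such bundles $v_j(y)=\sum_{i\in\Omega} v_{ij}y_i$). An allocation $x\in\mathbb Z_{\ge 0}^{\Omega\times N}$ is feasible if $\sum_{j\in N}x_{ij}\le b_i$ for all $i\in\Omega$ and $\sum_{i\in\Omega}x_{ij}\le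 d_j$ for all $j\in N$. A feasible allocation is stable at $p$ if $(x_{ij})_{i\in\Omega}$ is a preferred bundle of $j$ for every $j\in N$. It is market-clearing if $\sum_{i\in\Omega}\sum_{j\in N}x_{ij}=\min\{\sum_{i\in\Omega} b_i,\sum_{j\in N} d_j\}$. Prices $p\in\mathbb R_{\ge 0}^\Omega$ are Walrasian if there is an allocation that is stable at $p$ and market-clearing. They are buyer-optimal Walrasian prices if, in addition, $\sum_{i\in\Omega}p(i)$ is minimum among all Walrasian prices. **Theorem.** Let $p$ be buyer-optimal Walrasian prices of the market with values $v$, demands $d$ and supplies $b$. Consider a second market with the same values $v$, demands $d^{\mathrm{new}}\in\mathbb Z_{\ge 0}^N$ with $d_j\le d^{\mathrm{new}}_j$ for all $j\in N$, and supplies $b^{\mathrm{new}}\in\mathbb Z_{\ge 0}^\Omega$ with $b^{\mathrm{new}}_i\le b_i$ for all $i\in\Omega$, and let $p^{\mathrm{new}}$ be buyer-optimal Walrasian prices of the second market. Then $$p(i)\le p^{\mathrm{new}}(i)\qquad\text{for all } i\in\Omega \text{ with } b^{\mathrm{new}}_i>0.$$ -/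

import Mathlib

open scoped BigOperators

/-- A multi-unit market with object types `Ω` and buyers `N`: `value i j` is the value that buyer
`j` has per unit of object `i`, `demand j` is the maximum number of units that buyer `j` wants, and
`supply i` is the number of identical copies of object `i`. -/
structure MultiUnitMarket (Ω N : Type*) where
  value : Ω → N → ℕ
  demand : N → ℕ
  supply : Ω → ℕ

namespace MultiUnitMarket

variable {Ω N : Type*} [Fintype Ω] [Fintype N]

/-- The bundles available to buyer `j`: at most `supply i` units of each object `i`, and at most
`demand j` units in total. On these bundles the truncated additive valuation of `j` (the maximum of
`∑ i, value i j * y' i` over all `y' ≤ y` with at most `demand j` units) is additive. -/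
def bundles (M : MultiUnitMarket Ω N) (j : N) : Set (Ω → ℕ) :=
  {y | ∑ i, y i ≤ M.demand j ∧ ∀ i, y i ≤ M.supply i}

/-- The utility of buyer `j` from the bundle `y` (with at most `demand j` units) at prices `p`. -/
def utility (M : MultiUnitMarket Ω N) (p : Ω → ℝ) (j : N) (y : Ω → ℕ) : ℝ :=
  ∑ i, ((M.value i j : ℝ) - p i) * (y i : ℝ)

/-- The set of preferred bundles of buyer `j` at prices `p`. -/
def demandSet (M : MultiUnitMarket Ω N) (p : Ω → ℝ) (j : N) : Set (Ω → ℕ) :=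
  {y | y ∈ M.bundles j ∧ ∀ z ∈ M.bundles j, M.utility p j z ≤ M.utility p j y}

/-- An allocation gives `x i j` units of object `i` to buyer `j`. It is feasible if at most
`supply i` units of each object `i` are sold and each buyer `j` gets at most `demand j` units. -/
def IsFeasible (M : MultiUnitMarket Ω N) (x : Ω → N → ℕ) : Prop :=
  (∀ i, ∑ j, x i j ≤ M.supply i) ∧ ∀ j, ∑ i, x i j ≤ M.demand j

/-- A feasible allocation that gives every buyer one of her preferred bundles. -/
def IsStable (M : MultiUnitMarket Ω N) (p : Ω → ℝ) (x : Ω → N → ℕ) : Prop :=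
  M.IsFeasible x ∧ ∀ j, (fun i => x i j) ∈ M.demandSet p j

/-- As many units as possible are sold. -/
def IsMarketClearing (M : MultiUnitMarket Ω N) (x : Ω → N → ℕ) : Prop :=
  ∑ i, ∑ j, x i j = min (∑ i, M.supply i) (∑ j, M.demand j)

/-- Nonnegative prices that support a stable, market-clearing allocation. -/
def IsWalrasian (M : MultiUnitMarket Ω N) (p : Ω → ℝ) : Prop :=
  (∀ i, 0 ≤ p i) ∧ ∃ x : Ω → N → ℕ, M.IsStable p x ∧ M.IsMarketClearing x

/-- Walrasian prices whose sum is minimum among all Walrasian prices. -/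
def IsBuyerOptimal (M : MultiUnitMarket Ω N) (p : Ω → ℝ) : Prop :=
  M.IsWalrasian p ∧ ∀ q : Ω → ℝ, M.IsWalrasian q → ∑ i, p i ≤ ∑ i, q i

end MultiUnitMarket

/-!
Let `x` be an allocation that supports `p` and `y` one that supports `pNew`, and let `r` be the
pointwise minimum of `p` and `pNew` on the objects with positive new supply, and `p` elsewhere. The
allocation `x` is shown to be stable at `r` in the old market (`MultiUnitMarket.isStable_min`).
As `p` has the smallest sum among all Walrasian prices, this forces `r = p`, which is the claim.

The tool is linear programming duality. A bundle of buyer `j` is preferred exactly if there is a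
threshold `τ j ≥ 0` with which it satisfies complementary slackness (`IsThreshold`), so an
allocation is stable at `p`, with only objects of price zero not sold out, exactly if it closes the
gap to the dual objective
`∑ j, demand j * τ j + ∑ i, supply i * (p i + ∑ j, max (value i j - p i - τ j) 0)`
of welfare maximization at suitable `τ` (`dual_sub_welfare`). This objective is submodular in
`(p, -τ)` (`unitCost_submodular`), and passing to larger demands and smaller supplies only makes
raising prices and lowering thresholds more attractive. Since `y` shows that raising `pNew` does not
decrease the new objective (`dual_le_dual_of_le`), lowering `p` to `r` does not increase the old one,
so `x` still closes the gap. The units of an object that leave the market have to be treated as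
keeping their price `p i`; splitting `x` proportionally between the remaining and the leaving units
brings the conclusion back to a single price per object.

The argument needs that unsold units have price zero under `x`. When supply exceeds demand this is
not part of market clearing, but it follows from buyer-optimality by an alternating path argument
(`IsBuyerOptimal.exists_unsold_eq_zero`).
-/

namespace MultiUnitMarket

variable {Ω N : Type*}

/-! ### Preferred bundles and surplus thresholds -/

/-- The bundle that arises from `y` when a unit of `k` is exchanged for a unit of `i`. It is described
additively, which avoids truncated subtraction and includes the case `i = k`. -/
theorem exists_exchange [DecidableEq Ω] (y : Ω → ℕ) {k i : Ω} (hk : 0 < y k) :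
    ∃ y' : Ω → ℕ, ∀ a, y' a + (if a = k then 1 else 0) = y a + (if a = i then 1 else 0) :=
  ⟨fun a => y a + (if a = i then 1 else 0) - (if a = k then 1 else 0), fun a => by
    by_cases h : a = k
    · subst h; simp; omega
    · simp [h]⟩

section Bundles

variable [Fintype Ω]

/-- `τ` is a marginal utility of demand of buyer `j` that certifies the optimality of the bundle
`y` at prices `p`: it is the complementary slackness condition, with dual variable `τ`, for the
linear program that the preferred bundles solve. -/
structure IsThreshold (M : MultiUnitMarket Ω N) (p : Ω → ℝ) (j : N) (y : Ω → ℕ) (τ : ℝ) :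
    Prop where
  nonneg : 0 ≤ τ
  eq_zero : ∑ i, y i < M.demand j → τ = 0
  le_of_pos : ∀ i, 0 < y i → τ ≤ M.value i j - p i
  ge_of_lt : ∀ i, y i < M.supply i → M.value i j - p i ≤ τ

theorem IsThreshold.mem_demandSet {M : MultiUnitMarket Ω N} {p : Ω → ℝ} {j : N} {y : Ω → ℕ}
    {τ : ℝ} (h : M.IsThreshold p j y τ) (hy : y ∈ M.bundles j) : y ∈ M.demandSet p j := by
  refine ⟨hy, fun z hz => ?_⟩
  have h1 : ∀ i, ((M.value i j : ℝ) - p i) * z i ≤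
      ((M.value i j : ℝ) - p i) * y i + τ * (z i - y i) := by
    intro i
    rcases lt_trichotomy (z i) (y i) with hlt | heq | hgt
    · have h2 := h.le_of_pos i (by omega)
      have h3 : (z i : ℝ) < y i := by exact_mod_cast hlt
      nlinarith
    · rw [heq]; simp
    · have h2 := h.ge_of_lt i (hgt.trans_le (hz.2 i))
      have h3 : (y i : ℝ) < z i := by exact_mod_cast hgt
      nlinarith
  have h2 : τ * (∑ i, (z i : ℝ) - ∑ i, (y i : ℝ)) ≤ 0 := by
    by_cases hlt : ∑ i, y i < M.demand j
    · simp [h.eq_zero hlt]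
    · have h3 : ∑ i, z i ≤ ∑ i, y i := hz.1.trans (not_lt.1 hlt)
      have h4 : (∑ i, (z i : ℝ)) ≤ ∑ i, (y i : ℝ) := by exact_mod_cast h3
      exact mul_nonpos_of_nonneg_of_nonpos h.nonneg (by linarith)
  have h3 := Finset.sum_le_sum fun i (_ : i ∈ Finset.univ) => h1 i
  rw [Finset.sum_add_distrib, ← Finset.mul_sum, Finset.sum_sub_distrib] at h3
  unfold utility
  linarith

theorem sum_add_single [DecidableEq Ω] {y y' : Ω → ℕ} {k i : Ω}
    (h : ∀ a, y' a + (if a = k then 1 else 0) = y a + (if a = i then 1 else 0)) :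
    ∑ a, y' a = ∑ a, y a := by
  have := Finset.sum_congr rfl fun a (_ : a ∈ Finset.univ) => h a
  simpa [Finset.sum_add_distrib] using this

theorem utility_exchange [DecidableEq Ω] (M : MultiUnitMarket Ω N) (p : Ω → ℝ) (j : N)
    {y y' : Ω → ℕ} {k i : Ω}
    (h : ∀ a, y' a + (if a = k then 1 else 0) = y a + (if a = i then 1 else 0)) :
    M.utility p j y' + (M.value k j - p k) = M.utility p j y + (M.value i j - p i) := by
  have h1 : ∀ a, ((M.value a j : ℝ) - p a) * y' a +
      (if a = k then (M.value a j : ℝ) - p a else 0) =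
      ((M.value a j : ℝ) - p a) * y a + (if a = i then (M.value a j : ℝ) - p a else 0) := by
    intro a
    have h2 : (y' a : ℝ) + (if a = k then 1 else 0) = y a + (if a = i then 1 else 0) := by
      exact_mod_cast h a
    have h3 := congrArg (fun t => ((M.value a j : ℝ) - p a) * t) h2
    simpa [mul_add] using h3
  have := Finset.sum_congr rfl fun a (_ : a ∈ Finset.univ) => h1 a
  simpa [Finset.sum_add_distrib, utility] using this

theorem mem_bundles_exchange [DecidableEq Ω] {M : MultiUnitMarket Ω N} {j : N}
    {y y' : Ω → ℕ} {k i : Ω} (hy : y ∈ M.bundles j) (hi : y i < M.supply i)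
    (h : ∀ a, y' a + (if a = k then 1 else 0) = y a + (if a = i then 1 else 0)) :
    y' ∈ M.bundles j := by
  refine ⟨(sum_add_single h).le.trans hy.1, fun a => ?_⟩
  have h1 := h a
  have h2 := hy.2 a
  split_ifs at h1 <;> subst_vars <;> omega

theorem le_of_mem_demandSet {M : MultiUnitMarket Ω N} {p : Ω → ℝ} {j : N} {y : Ω → ℕ}
    (hy : y ∈ M.demandSet p j) {k i : Ω} (hk : 0 < y k) (hi : y i < M.supply i) :
    (M.value i j : ℝ) - p i ≤ M.value k j - p k := by
  classical
  obtain ⟨y', h⟩ := exists_exchange (i := i) y hk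
  have := M.utility_exchange p j h
  have := hy.2 y' (mem_bundles_exchange hy.1 hi h)
  linarith

theorem nonneg_of_mem_demandSet {M : MultiUnitMarket Ω N} {p : Ω → ℝ} {j : N} {y : Ω → ℕ}
    (hy : y ∈ M.demandSet p j) {k : Ω} (hk : 0 < y k) : (0 : ℝ) ≤ M.value k j - p k := by
  classical
  have hle : ∀ a, Function.update y k (y k - 1) a ≤ y a := by
    intro a
    by_cases h : a = k
    · subst h; simp
    · simp [h]
  have h1 := hy.2 (Function.update y k (y k - 1))
    ⟨(Finset.sum_le_sum fun a _ => hle a).trans hy.1.1, fun a => (hle a).trans (hy.1.2 a)⟩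
  unfold utility at h1
  rw [← Finset.add_sum_erase _ _ (Finset.mem_univ k),
    ← Finset.add_sum_erase _ (fun i => ((M.value i j : ℝ) - p i) * (y i : ℝ))
      (Finset.mem_univ k)] at h1
  have h2 : ∑ a ∈ Finset.univ.erase k,
      ((M.value a j : ℝ) - p a) * (Function.update y k (y k - 1) a : ℝ) =
      ∑ a ∈ Finset.univ.erase k, ((M.value a j : ℝ) - p a) * (y a : ℝ) :=
    Finset.sum_congr rfl fun a ha => by
      rw [Function.update_of_ne (Finset.ne_of_mem_erase ha)]
  rw [h2, Function.update_self, Nat.cast_sub (by omega)] at h1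
  push_cast at h1
  linarith

theorem nonpos_of_mem_demandSet {M : MultiUnitMarket Ω N} {p : Ω → ℝ} {j : N} {y : Ω → ℕ}
    (hy : y ∈ M.demandSet p j) (hlt : ∑ i, y i < M.demand j) {i : Ω} (hi : y i < M.supply i) :
    (M.value i j : ℝ) - p i ≤ 0 := by
  classical
  have h0 : ∀ a, Function.update y i (y i + 1) a = y a + (if a = i then 1 else 0) := by
    intro a
    by_cases h : a = i
    · subst h; simp
    · simp [h]
  have h1 := hy.2 (Function.update y i (y i + 1)) ⟨by
    simp only [h0, Finset.sum_add_distrib]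
    simpa using hlt, fun a => by
    rw [h0]
    have := hy.1.2 a
    split_ifs with h
    · subst h; omega
    · omega⟩
  unfold utility at h1
  simp only [h0, Nat.cast_add, mul_add, Finset.sum_add_distrib] at h1
  simpa using h1

/-- Single exchanges suffice to certify optimality: the best unit that is still available, if it has
nonnegative surplus, gives the threshold. -/
theorem exists_isThreshold_of_exchange {M : MultiUnitMarket Ω N} {p : Ω → ℝ} {j : N} {y : Ω → ℕ}
    (hex : ∀ k i, 0 < y k → y i < M.supply i →
      (M.value i j : ℝ) - p i ≤ M.value k j - p k)
    (hnn : ∀ k, 0 < y k → (0 : ℝ) ≤ M.value k j - p k)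
    (hnp : ∑ i, y i < M.demand j → ∀ i, y i < M.supply i → (M.value i j : ℝ) - p i ≤ 0) :
    ∃ τ, M.IsThreshold p j y τ := by
  classical
  by_cases hlt : ∑ i, y i < M.demand j
  · exact ⟨0, le_rfl, fun _ => rfl, hnn, hnp hlt⟩
  by_cases hne : (Finset.univ.filter fun i => y i < M.supply i).Nonempty
  · obtain ⟨m, hm, hmax⟩ := Finset.exists_max_image _ (fun i => (M.value i j : ℝ) - p i) hne
    rw [Finset.mem_filter] at hm
    refine ⟨max 0 (M.value m j - p m), le_max_left _ _, fun h => (hlt h).elim,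
      fun k hk => max_le (hnn k hk) (hex k m hk hm.2),
      fun i hi => (hmax i (by simpa using hi)).trans (le_max_right _ _)⟩
  · exact ⟨0, le_rfl, fun _ => rfl, hnn, fun i hi => (hne ⟨i, by simpa using hi⟩).elim⟩

theorem exists_isThreshold {M : MultiUnitMarket Ω N} {p : Ω → ℝ} {j : N} {y : Ω → ℕ}
    (hy : y ∈ M.demandSet p j) : ∃ τ, M.IsThreshold p j y τ :=
  exists_isThreshold_of_exchange (fun _ _ => le_of_mem_demandSet hy)
    (fun _ => nonneg_of_mem_demandSet hy) (fun hlt _ => nonpos_of_mem_demandSet hy hlt)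

end Bundles

theorem IsFeasible.mem_bundles [Fintype Ω] [Fintype N] {M : MultiUnitMarket Ω N} {x : Ω → N → ℕ} (h : M.IsFeasible x)
    (j : N) : (fun i => x i j) ∈ M.bundles j :=
  ⟨h.2 j, fun i => (Finset.single_le_sum (fun _ _ => Nat.zero_le _) (Finset.mem_univ j)).trans
    (h.1 i)⟩

/-! ### The dual objective -/

theorem max_sub_submodular (v p q s t : ℝ) :
    max (v - min p q - max s t) 0 + max (v - max p q - min s t) 0 ≤
      max (v - p - s) 0 + max (v - q - t) 0 := by
  rcases le_total p q with h | h <;> rcases le_total s t with h' | h' <;>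
    simp only [h, h', min_eq_left, min_eq_right, max_eq_left, max_eq_right] <;>
    grind

theorem demand_submodular {d d' s t : ℝ} (h : d ≤ d') :
    d * max s t + d' * min s t ≤ d * s + d' * t := by
  rcases le_total s t with h' | h' <;>
    simp only [h', min_eq_left, min_eq_right, max_eq_left, max_eq_right] <;> nlinarith

section UnitCost

variable [Fintype N]

/-- The coefficient of the supply of object `i` in the dual of the welfare maximization problem,
at price `π` of object `i` and marginal utilities `τ` of demand. -/
def unitCost (M : MultiUnitMarket Ω N) (i : Ω) (π : ℝ) (τ : N → ℝ) : ℝ :=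
  π + ∑ j, max (M.value i j - π - τ j) 0

theorem unitCost_anti (M : MultiUnitMarket Ω N) (i : Ω) (π : ℝ) {τ τ' : N → ℝ} (h : τ ≤ τ') :
    M.unitCost i π τ' ≤ M.unitCost i π τ := by
  unfold unitCost
  gcongr with j
  exact h j

/-- The dual objective is submodular once the order on the marginal utilities is reversed. -/
theorem unitCost_submodular (M : MultiUnitMarket Ω N) (i : Ω) (p q : ℝ) (s t : N → ℝ) :
    M.unitCost i (min p q) (fun j => max (s j) (t j)) +
        M.unitCost i (max p q) (fun j => min (s j) (t j)) ≤
      M.unitCost i p s + M.unitCost i q t := by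
  have h := Finset.sum_le_sum fun j (_ : j ∈ Finset.univ) =>
    max_sub_submodular (M.value i j) p q (s j) (t j)
  simp only [Finset.sum_add_distrib] at h
  have := min_add_max p q
  unfold unitCost
  linarith

/-- The excess of the dual cost of object `i` over the surplus that its sold units create. -/
def objectSlack (M : MultiUnitMarket Ω N) (x : Ω → N → ℕ) (i : Ω) (π : ℝ) (τ : N → ℝ) : ℝ :=
  M.supply i * M.unitCost i π τ - ∑ j, (M.value i j - τ j) * (x i j : ℝ)

theorem objectSlack_eq (M : MultiUnitMarket Ω N) (x : Ω → N → ℕ) (i : Ω) (π : ℝ) (τ : N → ℝ) :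
    M.objectSlack x i π τ = (M.supply i - ∑ j, (x i j : ℝ)) * π +
      ∑ j, ((M.supply i - x i j) * max (M.value i j - π - τ j) 0 +
        x i j * max (-(M.value i j - π - τ j)) 0) := by
  have h : ∀ j, ((M.supply i : ℝ) - x i j) * max (M.value i j - π - τ j) 0 +
        x i j * max (-(M.value i j - π - τ j)) 0 =
      M.supply i * max (M.value i j - π - τ j) 0 - (M.value i j - τ j) * (x i j : ℝ)
        + x i j * π := by
    intro j
    rcases le_total 0 ((M.value i j : ℝ) - π - τ j) with h | h
    · rw [max_eq_left h, max_eq_right (by linarith)]; ring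
    · rw [max_eq_right h, max_eq_left (by linarith)]; ring
  simp only [h, objectSlack, unitCost, Finset.sum_add_distrib, Finset.sum_sub_distrib,
    ← Finset.mul_sum, ← Finset.sum_mul]
  ring

end UnitCost

variable [Fintype Ω] [Fintype N]

theorem IsFeasible.exchangeTerm_nonneg {M : MultiUnitMarket Ω N} {x : Ω → N → ℕ}
    (h : M.IsFeasible x) (i : Ω) (j : N) (a : ℝ) :
    0 ≤ ((M.supply i : ℝ) - x i j) * max a 0 + x i j * max (-a) 0 := by
  have h1 : (x i j : ℝ) ≤ M.supply i := by exact_mod_cast (h.mem_bundles j).2 i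
  have : (0 : ℝ) ≤ (M.supply i : ℝ) - x i j := by linarith
  positivity

theorem IsFeasible.le_objectSlack {M : MultiUnitMarket Ω N} {x : Ω → N → ℕ}
    (h : M.IsFeasible x) (i : Ω) (π : ℝ) (τ : N → ℝ) :
    (M.supply i - ∑ j, (x i j : ℝ)) * π ≤ M.objectSlack x i π τ := by
  rw [objectSlack_eq]
  have := Finset.sum_nonneg fun j (_ : j ∈ Finset.univ) =>
    h.exchangeTerm_nonneg i j (M.value i j - π - τ j)
  linarith

theorem IsFeasible.sum_le_supply {M : MultiUnitMarket Ω N} {x : Ω → N → ℕ}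
    (h : M.IsFeasible x) (i : Ω) : ∑ j, (x i j : ℝ) ≤ M.supply i := by
  exact_mod_cast h.1 i

theorem IsFeasible.sum_le_demand {M : MultiUnitMarket Ω N} {x : Ω → N → ℕ}
    (h : M.IsFeasible x) (j : N) : ∑ i, (x i j : ℝ) ≤ M.demand j := by
  exact_mod_cast h.2 j

theorem objectSlack_of_isThreshold {M : MultiUnitMarket Ω N} {x : Ω → N → ℕ} {p : Ω → ℝ}
    {τ : N → ℝ} (h : M.IsFeasible x) (hτ : ∀ j, M.IsThreshold p j (fun i => x i j) (τ j))
    (i : Ω) : M.objectSlack x i (p i) τ = (M.supply i - ∑ j, (x i j : ℝ)) * p i := by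
  rw [objectSlack_eq, add_eq_left]
  refine Finset.sum_eq_zero fun j _ => ?_
  have h1 : ((M.supply i : ℝ) - x i j) * max (M.value i j - p i - τ j) 0 = 0 := by
    rcases ((h.mem_bundles j).2 i).lt_or_eq with hlt | heq
    · rw [max_eq_right (by linarith [(hτ j).ge_of_lt i hlt]), mul_zero]
    · have : (x i j : ℝ) = M.supply i := by exact_mod_cast heq
      rw [this, sub_self, zero_mul]
  have h2 : (x i j : ℝ) * max (-(M.value i j - p i - τ j)) 0 = 0 := by
    rcases Nat.eq_zero_or_pos (x i j) with h0 | hpos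
    · simp [h0]
    · rw [max_eq_right (by linarith [(hτ j).le_of_pos i hpos]), mul_zero]
  rw [h1, h2, add_zero]

theorem complementary_of_objectSlack_eq_zero {M : MultiUnitMarket Ω N} {x : Ω → N → ℕ} {i : Ω}
    {π : ℝ} {τ : N → ℝ} (h : M.IsFeasible x) (hπ : 0 ≤ π) (h0 : M.objectSlack x i π τ = 0)
    (j : N) :
    (0 < x i j → τ j ≤ M.value i j - π) ∧ (x i j < M.supply i → M.value i j - π ≤ τ j) := by
  rw [objectSlack_eq] at h0
  have hn : ∀ j ∈ Finset.univ, 0 ≤ ((M.supply i : ℝ) - x i j) * max (M.value i j - π - τ j) 0 +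
      x i j * max (-(M.value i j - π - τ j)) 0 := fun j _ =>
    h.exchangeTerm_nonneg i j (M.value i j - π - τ j)
  have h1 := mul_nonneg (sub_nonneg.2 (h.sum_le_supply i)) hπ
  have h2 := (Finset.sum_eq_zero_iff_of_nonneg hn).1
    (le_antisymm (by linarith) (Finset.sum_nonneg hn)) j (Finset.mem_univ j)
  have h3 : (x i j : ℝ) ≤ M.supply i := by exact_mod_cast (h.mem_bundles j).2 i
  have h4 : 0 ≤ ((M.supply i : ℝ) - x i j) * max (M.value i j - π - τ j) 0 :=
    mul_nonneg (by linarith) (le_max_right _ _)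
  have h5 : 0 ≤ (x i j : ℝ) * max (-(M.value i j - π - τ j)) 0 := by positivity
  constructor
  · intro hpos
    have h6 : (0 : ℝ) < x i j := by exact_mod_cast hpos
    have h7 := (mul_eq_zero.1 (le_antisymm (by linarith) h5)).resolve_left h6.ne'
    linarith [max_eq_right_iff.1 h7]
  · intro hlt
    have h6 : (x i j : ℝ) < M.supply i := by exact_mod_cast hlt
    have h7 := (mul_eq_zero.1 (le_antisymm (by linarith) h4)).resolve_left (by linarith)
    linarith [max_eq_right_iff.1 h7]

/-- The gap between the dual objective and the welfare of an allocation, as a sum of slacks. -/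
theorem dual_sub_welfare (M : MultiUnitMarket Ω N) (x : Ω → N → ℕ) (p : Ω → ℝ) (τ : N → ℝ) :
    ∑ j, (M.demand j : ℝ) * τ j + ∑ i, (M.supply i : ℝ) * M.unitCost i (p i) τ
        - ∑ i, ∑ j, (M.value i j : ℝ) * x i j =
      ∑ j, (M.demand j - ∑ i, (x i j : ℝ)) * τ j + ∑ i, M.objectSlack x i (p i) τ := by
  have h : ∑ i, ∑ j, τ j * (x i j : ℝ) = ∑ j, (∑ i, (x i j : ℝ)) * τ j := by
    rw [Finset.sum_comm]
    exact Finset.sum_congr rfl fun j _ => by rw [← Finset.mul_sum, mul_comm]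
  simp only [objectSlack, sub_mul, Finset.sum_sub_distrib, h]
  ring

/-- A stable allocation makes the prices minimize the dual objective among all higher prices:
raising prices cannot pay, even if unsold units have positive prices. -/
theorem dual_le_dual_of_le {M : MultiUnitMarket Ω N} {x : Ω → N → ℕ} {p p' : Ω → ℝ}
    {τ τ' : N → ℝ} (h : M.IsFeasible x)
    (hτ : ∀ j, M.IsThreshold p j (fun i => x i j) (τ j)) (hp : ∀ i, p i ≤ p' i)
    (hτ' : ∀ j, 0 ≤ τ' j) :
    ∑ j, (M.demand j : ℝ) * τ j + ∑ i, (M.supply i : ℝ) * M.unitCost i (p i) τ ≤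
      ∑ j, (M.demand j : ℝ) * τ' j + ∑ i, (M.supply i : ℝ) * M.unitCost i (p' i) τ' := by
  have h1 := M.dual_sub_welfare x p τ
  have h2 := M.dual_sub_welfare x p' τ'
  have h3 : ∑ j, (M.demand j - ∑ i, (x i j : ℝ)) * τ j = 0 :=
    Finset.sum_eq_zero fun j _ => by
      rcases (h.2 j).lt_or_eq with hlt | heq
      · rw [(hτ j).eq_zero hlt, mul_zero]
      · have : ∑ i, (x i j : ℝ) = M.demand j := by exact_mod_cast heq
        rw [this, sub_self, zero_mul]
  have h4 : 0 ≤ ∑ j, (M.demand j - ∑ i, (x i j : ℝ)) * τ' j :=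
    Finset.sum_nonneg fun j _ => mul_nonneg (sub_nonneg.2 (h.sum_le_demand j)) (hτ' j)
  have h5 : ∑ i, M.objectSlack x i (p i) τ ≤ ∑ i, M.objectSlack x i (p' i) τ' :=
    Finset.sum_le_sum fun i _ => by
      rw [objectSlack_of_isThreshold h hτ]
      exact (mul_le_mul_of_nonneg_left (hp i) (sub_nonneg.2 (h.sum_le_supply i))).trans
        (h.le_objectSlack i _ _)
  linarith

/-! ### Comparison of two markets -/

/-- The old allocation remains stable when every price is lowered to the new price wherever the
new supply is positive and the new price is lower. -/
theorem isStable_min {v : Ω → N → ℕ} {d dNew : N → ℕ} {b bNew : Ω → ℕ}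
    (hd : ∀ j, d j ≤ dNew j) (hb : ∀ i, bNew i ≤ b i) {p q r : Ω → ℝ} {x y : Ω → N → ℕ}
    (hp0 : ∀ i, 0 ≤ p i) (hq0 : ∀ i, 0 ≤ q i)
    (hx : (mk v d b).IsStable p x) (hunsold : ∀ i, ∑ j, x i j < b i → p i = 0)
    (hy : (mk v dNew bNew).IsStable q y)
    (hr0 : ∀ i, bNew i = 0 → r i = p i) (hr : ∀ i, 0 < bNew i → r i = min (p i) (q i)) :
    (mk v d b).IsStable r x := by
  set M := mk v d b
  choose s hs using fun j => exists_isThreshold (hx.2 j)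
  choose t ht using fun j => exists_isThreshold (hy.2 j)
  have hr_nonneg : ∀ i, 0 ≤ r i := fun i => by
    rcases Nat.eq_zero_or_pos (bNew i) with h | h
    · rw [hr0 i h]; exact hp0 i
    · rw [hr i h]; exact le_min (hp0 i) (hq0 i)
  set τ : N → ℝ := fun j => max (s j) (t j) with hτ
  set σ : N → ℝ := fun j => min (s j) (t j) with hσ
  have hτ0 : ∀ j, 0 ≤ τ j := fun j => (hs j).nonneg.trans (le_max_left _ _)
  have hσ0 : ∀ j, 0 ≤ σ j := fun j => le_min (hs j).nonneg (ht j).nonneg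
  -- A fraction `θ i` of the units of object `i` is kept and gets price `r i`, the rest is removed
  -- and keeps price `p i`; the sold units of `i` are split in the same proportion.
  set θ : Ω → ℝ := fun i => (bNew i : ℝ) / b i with hθ
  have hbr : ∀ i, (bNew i : ℝ) ≤ b i := fun i => by exact_mod_cast hb i
  have hθ0 : ∀ i, 0 ≤ θ i := fun i => by positivity
  have hθ1 : ∀ i, θ i ≤ 1 := fun i => div_le_one_of_le₀ (hbr i) (by positivity)
  have hθb : ∀ i, θ i * b i = bNew i := fun i => by
    rcases Nat.eq_zero_or_pos (b i) with h | h
    · have := hb i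
      have h0 : bNew i = 0 := by omega
      simp [h, h0]
    · have : (b i : ℝ) ≠ 0 := by positivity
      simp only [hθ]
      field_simp
  -- The cost per unit of an object involves neither demands nor supplies.
  have hnew : ∑ j, (dNew j : ℝ) * t j + ∑ i, (bNew i : ℝ) * M.unitCost i (q i) t ≤
      ∑ j, (dNew j : ℝ) * σ j + ∑ i, (bNew i : ℝ) * M.unitCost i (max (p i) (q i)) σ :=
    dual_le_dual_of_le hy.1 ht (fun i => le_max_right _ _) hσ0
  have hold : ∑ j, (d j : ℝ) * s j + ∑ i, (b i : ℝ) * M.unitCost i (p i) s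
        - ∑ i, ∑ j, (M.value i j : ℝ) * x i j =
      ∑ j, (M.demand j - ∑ i, (x i j : ℝ)) * s j + ∑ i, M.objectSlack x i (p i) s :=
    M.dual_sub_welfare x p s
  have hslack_s : ∑ i, M.objectSlack x i (p i) s = 0 := Finset.sum_eq_zero fun i _ => by
    rw [objectSlack_of_isThreshold hx.1 hs]
    rcases (hx.1.1 i).lt_or_eq with hlt | heq
    · rw [hunsold i hlt, mul_zero]
    · have : ∑ j, (x i j : ℝ) = M.supply i := by exact_mod_cast heq
      rw [this, sub_self, zero_mul]
  have hdem_s : ∑ j, (M.demand j - ∑ i, (x i j : ℝ)) * s j = 0 :=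
    Finset.sum_eq_zero fun j _ => by
      rcases (hx.1.2 j).lt_or_eq with hlt | heq
      · rw [(hs j).eq_zero hlt, mul_zero]
      · have : ∑ i, (x i j : ℝ) = M.demand j := by exact_mod_cast heq
        rw [this, sub_self, zero_mul]
  have hdem : ∑ j, ((d j : ℝ) * τ j + dNew j * σ j) ≤ ∑ j, ((d j : ℝ) * s j + dNew j * t j) :=
    Finset.sum_le_sum fun j _ => demand_submodular (by exact_mod_cast hd j)
  have hobj : ∀ i, θ i * M.objectSlack x i (r i) τ + (1 - θ i) * M.objectSlack x i (p i) τ +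
      bNew i * M.unitCost i (max (p i) (q i)) σ ≤
      b i * M.unitCost i (p i) s + bNew i * M.unitCost i (q i) t
        - ∑ j, (M.value i j - τ j) * (x i j : ℝ) := by
    intro i
    have h1 : θ i * M.objectSlack x i (r i) τ + (1 - θ i) * M.objectSlack x i (p i) τ =
        bNew i * M.unitCost i (r i) τ + (b i - bNew i) * M.unitCost i (p i) τ
          - ∑ j, (M.value i j - τ j) * (x i j : ℝ) := by
      rw [← hθb i]
      simp only [objectSlack, M]
      ring
    have h2 : M.unitCost i (p i) τ ≤ M.unitCost i (p i) s :=
      M.unitCost_anti i _ fun j => le_max_left _ _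
    have h3 := mul_le_mul_of_nonneg_left h2 (sub_nonneg.2 (hbr i))
    have h4 : (bNew i : ℝ) * (M.unitCost i (r i) τ + M.unitCost i (max (p i) (q i)) σ) ≤
        bNew i * (M.unitCost i (p i) s + M.unitCost i (q i) t) := by
      rcases Nat.eq_zero_or_pos (bNew i) with h | h
      · simp [h]
      · rw [hr i h]
        exact mul_le_mul_of_nonneg_left (M.unitCost_submodular i _ _ _ _) (by positivity)
    rw [h1]
    linarith
  have hobj' := Finset.sum_le_sum fun i (_ : i ∈ Finset.univ) => hobj i
  have hsplit : ∑ i, ∑ j, ((M.value i j : ℝ) - τ j) * (x i j : ℝ) =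
      ∑ i, ∑ j, (M.value i j : ℝ) * x i j - ∑ j, (∑ i, (x i j : ℝ)) * τ j := by
    simp only [sub_mul, Finset.sum_sub_distrib]
    congr 1
    rw [Finset.sum_comm]
    exact Finset.sum_congr rfl fun j _ => by rw [← Finset.mul_sum, mul_comm]
  have hterm : ∀ i, 0 ≤ M.objectSlack x i (r i) τ ∧ 0 ≤ M.objectSlack x i (p i) τ := fun i =>
    ⟨(mul_nonneg (sub_nonneg.2 (hx.1.sum_le_supply i)) (hr_nonneg i)).trans
      (hx.1.le_objectSlack i _ _),
    (mul_nonneg (sub_nonneg.2 (hx.1.sum_le_supply i)) (hp0 i)).trans (hx.1.le_objectSlack i _ _)⟩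
  have hn1 : ∀ i ∈ Finset.univ, 0 ≤ θ i * M.objectSlack x i (r i) τ +
      (1 - θ i) * M.objectSlack x i (p i) τ := fun i _ =>
    add_nonneg (mul_nonneg (hθ0 i) (hterm i).1)
      (mul_nonneg (sub_nonneg.2 (hθ1 i)) (hterm i).2)
  have hn2 : ∀ j ∈ Finset.univ, 0 ≤ (M.demand j - ∑ i, (x i j : ℝ)) * τ j := fun j _ =>
    mul_nonneg (sub_nonneg.2 (hx.1.sum_le_demand j)) (hτ0 j)
  have htotal : ∑ j, (M.demand j - ∑ i, (x i j : ℝ)) * τ j +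
      ∑ i, (θ i * M.objectSlack x i (r i) τ + (1 - θ i) * M.objectSlack x i (p i) τ) ≤ 0 := by
    have h1 : ∑ j, (M.demand j - ∑ i, (x i j : ℝ)) * τ j =
        ∑ j, (d j : ℝ) * τ j - ∑ j, (∑ i, (x i j : ℝ)) * τ j := by
      simp only [sub_mul, Finset.sum_sub_distrib, M]
    simp only [Finset.sum_add_distrib, Finset.sum_sub_distrib] at hobj' ⊢
    rw [Finset.sum_add_distrib, Finset.sum_add_distrib] at hdem
    rw [h1]
    linarith
  have hz1 := (Finset.sum_eq_zero_iff_of_nonneg hn1).1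
    (le_antisymm (by linarith [Finset.sum_nonneg hn2]) (Finset.sum_nonneg hn1))
  have hz2 := (Finset.sum_eq_zero_iff_of_nonneg hn2).1
    (le_antisymm (by linarith [Finset.sum_nonneg hn1]) (Finset.sum_nonneg hn2))
  have hzero : ∀ i, M.objectSlack x i (r i) τ = 0 := by
    intro i
    have h1 := hz1 i (Finset.mem_univ i)
    rcases Nat.eq_zero_or_pos (bNew i) with h | h
    · have h2 : θ i = 0 := by simp [hθ, h]
      rw [h2] at h1
      rw [hr0 i h]
      linarith
    · have h2 : 0 < θ i := by
        have : 0 < b i := h.trans_le (hb i)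
        simp only [hθ]
        positivity
      have h3 := mul_nonneg (hθ0 i) (hterm i).1
      have h4 := mul_nonneg (sub_nonneg.2 (hθ1 i)) (hterm i).2
      exact (mul_eq_zero.1 (le_antisymm (by linarith) h3)).resolve_left h2.ne'
  refine ⟨hx.1, fun j => IsThreshold.mem_demandSet (τ := τ j) ⟨hτ0 j, fun hlt => ?_,
    fun i => (complementary_of_objectSlack_eq_zero hx.1 (hr_nonneg i) (hzero i) j).1,
    fun i => (complementary_of_objectSlack_eq_zero hx.1 (hr_nonneg i) (hzero i) j).2⟩
    (hx.1.mem_bundles j)⟩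
  have hlt' : ∑ i, (x i j : ℝ) < M.demand j := by exact_mod_cast hlt
  exact (mul_eq_zero.1 (hz2 j (Finset.mem_univ j))).resolve_left (by linarith)

/-! ### Unsold units at buyer-optimal prices -/

/-- Some buyer holds a unit of `k`, could hold a further unit of `i`, and is indifferent between
the two: she can give up a unit of `k` for an unsold unit of `i`. -/
def CanExchange (M : MultiUnitMarket Ω N) (p : Ω → ℝ) (x : Ω → N → ℕ) (i k : Ω) : Prop :=
  ∃ j, 0 < x k j ∧ x i j < M.supply i ∧ (M.value i j : ℝ) - p i = M.value k j - p k

/-- An unsold unit of `i` can be turned into an unsold unit of `k` by a single exchange. -/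
theorem IsStable.exists_exchange [DecidableEq Ω] {M : MultiUnitMarket Ω N} {p : Ω → ℝ}
    {x : Ω → N → ℕ} (hx : M.IsStable p x) {i k : Ω} (hi : ∑ j, x i j < M.supply i)
    (h : M.CanExchange p x i k) :
    ∃ x' : Ω → N → ℕ, M.IsStable p x' ∧ (∀ j, ∑ a, x' a j = ∑ a, x a j) ∧
      (∀ a, ∑ j, x' a j + (if a = k then 1 else 0) = ∑ j, x a j + (if a = i then 1 else 0)) ∧
      (∀ a j, a ≠ i → x' a j ≤ x a j) ∧ ∀ a j, a ≠ k → x a j ≤ x' a j := by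
  classical
  obtain ⟨j, hk, hij, htie⟩ := h
  obtain ⟨y, hy⟩ := MultiUnitMarket.exists_exchange (i := i) (fun a => x a j) hk
  set x' : Ω → N → ℕ := fun a l => if l = j then y a else x a l with hx'
  have hent : ∀ a l, x' a l + (if l = j then (if a = k then 1 else 0) else 0) =
      x a l + (if l = j then (if a = i then 1 else 0) else 0) := by
    intro a l
    by_cases hl : l = j
    · subst hl; simpa [hx'] using hy a
    · simp [hx', hl]
  have hrow : ∀ a, ∑ l, x' a l + (if a = k then 1 else 0) =
      ∑ l, x a l + (if a = i then 1 else 0) := by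
    intro a
    have := Finset.sum_congr rfl fun l (_ : l ∈ Finset.univ) => hent a l
    simpa [Finset.sum_add_distrib] using this
  have hcol : ∀ l, ∑ a, x' a l = ∑ a, x a l := by
    intro l
    by_cases hl : l = j
    · subst hl; simpa [hx'] using sum_add_single hy
    · simp [hx', hl]
  refine ⟨x', ⟨⟨fun a => ?_, fun l => (hcol l).le.trans (hx.1.2 l)⟩, fun l => ?_⟩, hcol, hrow,
    fun a l ha => ?_, fun a l ha => ?_⟩
  · have h1 := hrow a
    have h2 := hx.1.1 a
    split_ifs at h1 <;> subst_vars <;> omega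
  · by_cases hl : l = j
    · subst hl
      have h1 : (fun a => x' a l) = y := by simp [hx']
      have h2 := M.utility_exchange p l hy
      rw [h1]
      refine ⟨mem_bundles_exchange (hx.2 l).1 hij hy, fun z hz => ?_⟩
      have := (hx.2 l).2 z hz
      linarith
    · simpa [hx', hl] using hx.2 l
  · have := hent a l
    simp [ha] at this
    omega
  · have := hent a l
    simp [ha] at this
    omega

/-- An unsold unit can be moved along a simple path of exchanges; simplicity makes the exchanges
of the path independent of each other. -/
theorem IsStable.exists_exchange_path [DecidableEq Ω] {M : MultiUnitMarket Ω N} {p : Ω → ℝ}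
    (n : ℕ) : ∀ {x : Ω → N → ℕ}, M.IsStable p x → ∀ c : ℕ → Ω,
      (∀ s t, s < t → t ≤ n → c s ≠ c t) → ∑ j, x (c 0) j < M.supply (c 0) →
      (∀ t < n, M.CanExchange p x (c t) (c (t + 1))) →
    ∃ x' : Ω → N → ℕ, M.IsStable p x' ∧ (∀ j, ∑ a, x' a j = ∑ a, x a j) ∧
      ∀ a, ∑ j, x' a j + (if a = c n then 1 else 0) =
        ∑ j, x a j + (if a = c 0 then 1 else 0) := by
  induction n with
  | zero => exact fun {x} hx c _ _ _ => ⟨x, hx, fun _ => rfl, fun _ => rfl⟩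
  | succ n ih =>
    intro x hx c hinj hhole hedge
    obtain ⟨x₁, hx₁, hcol, hrow, hle, hge⟩ := hx.exists_exchange hhole (hedge 0 (by omega))
    have h01 : c 0 ≠ c (0 + 1) := hinj 0 1 (by omega) (by omega)
    obtain ⟨x', hx', hcol', hrow'⟩ := ih hx₁ (fun t => c (t + 1))
      (fun s t hst ht => hinj _ _ (by omega) (by omega))
      (by
        have h1 := hrow (c (0 + 1))
        rw [if_pos rfl, if_neg h01.symm] at h1
        have h2 := hx.1.1 (c (0 + 1))
        omega)
      (fun t ht => by
        obtain ⟨j, hk, hi, htie⟩ := hedge (t + 1) (by omega)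
        refine ⟨j, hk.trans_le (hge _ j ?_), (hle _ j ?_).trans_lt hi, htie⟩
        · exact (hinj (0 + 1) (t + 1 + 1) (by omega) (by omega)).symm
        · exact (hinj 0 (t + 1) (by omega) (by omega)).symm)
    refine ⟨x', hx', fun j => (hcol' j).trans (hcol j), fun a => ?_⟩
    have h1 := hrow' a
    have h2 := hrow a
    omega

theorem exists_simple_path {α : Type*} {R : α → α → Prop} {i k : α}
    (h : Relation.ReflTransGen R i k) :
    ∃ (n : ℕ) (c : ℕ → α), c 0 = i ∧ c n = k ∧ (∀ s t, s < t → t ≤ n → c s ≠ c t) ∧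
      ∀ t < n, R (c t) (c (t + 1)) := by
  classical
  have hex : ∃ n, ∃ c : ℕ → α, c 0 = i ∧ c n = k ∧ ∀ t < n, R (c t) (c (t + 1)) := by
    induction h with
    | refl => exact ⟨0, fun _ => i, rfl, rfl, by simp⟩
    | @tail b e _ hbe ih =>
      obtain ⟨n, c, h0, hn, hR⟩ := ih
      refine ⟨n + 1, fun t => if t ≤ n then c t else e, by simpa using h0, by simp, ?_⟩
      intro t ht
      rcases (Nat.lt_succ_iff.1 ht).lt_or_eq with hlt | rfl
      · simpa [hlt.le, Nat.succ_le_iff.2 hlt] using hR t hlt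
      · simpa [hn] using hbe
  obtain ⟨c, h0, hn, hR⟩ := Nat.find_spec hex
  refine ⟨Nat.find hex, c, h0, hn, fun s t hst ht heq => ?_, hR⟩
  -- A shortest path is simple: otherwise the part between two visits can be cut out.
  refine Nat.find_min hex (m := Nat.find hex - (t - s)) (by omega)
    ⟨fun u => if u ≤ s then c u else c (u + (t - s)), by simpa using h0, ?_, fun u hu => ?_⟩
  · by_cases hc : Nat.find hex - (t - s) ≤ s
    · have h1 : Nat.find hex - (t - s) = s := by omega
      have h2 : Nat.find hex = t := by omega
      simp only [h1, le_refl, if_true]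
      rw [heq, ← hn, h2]
    · simp only [hc, if_false]
      rw [show Nat.find hex - (t - s) + (t - s) = Nat.find hex by omega, hn]
  · rcases lt_trichotomy u s with hlt | rfl | hgt
    · simpa [hlt.le, Nat.succ_le_iff.2 hlt] using hR u (by omega)
    · have h1 := hR t (by omega)
      simp only [le_refl, if_true, show ¬ u + 1 ≤ u by omega, if_false]
      rw [heq, show u + 1 + (t - u) = t + 1 by omega]
      exact h1
    · simp only [show ¬ u ≤ s by omega, show ¬ u + 1 ≤ s by omega, if_false]
      rw [show u + 1 + (t - s) = u + (t - s) + 1 by omega]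
      exact hR _ (by omega)

/-- An allocation in which all demand is met stays stable if the prices of a set of objects that is
closed under exchanges are lowered slightly. -/
theorem IsStable.exists_lower [DecidableEq Ω] {M : MultiUnitMarket Ω N} {p : Ω → ℝ}
    {x : Ω → N → ℕ} (hx : M.IsStable p x) (hp : ∀ i, 0 ≤ p i)
    (hfull : ∀ j, ∑ i, x i j = M.demand j) (S : Finset Ω) (hS : ∀ i ∈ S, 0 < p i)
    (hclosed : ∀ i ∈ S, ∀ k, M.CanExchange p x i k → k ∈ S) :
    ∃ ε > 0, (∀ i, 0 ≤ p i - (if i ∈ S then ε else 0)) ∧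
      M.IsStable (fun i => p i - (if i ∈ S then ε else 0)) x := by
  have hev : ∀ {a : ℝ}, 0 < a → ∀ᶠ ε in nhdsWithin (0 : ℝ) (Set.Ioi 0), ε ≤ a := fun ha =>
    nhdsWithin_le_nhds (Iic_mem_nhds ha)
  have h1 : ∀ᶠ ε in nhdsWithin (0 : ℝ) (Set.Ioi 0), ∀ i, i ∈ S → ε ≤ p i :=
    Filter.eventually_all.2 fun i => by
      by_cases hi : i ∈ S
      · filter_upwards [hev (hS i hi)] with ε hε _ using hε
      · exact Filter.Eventually.of_forall fun ε h => (hi h).elim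
  have h2 : ∀ᶠ ε in nhdsWithin (0 : ℝ) (Set.Ioi 0), ∀ (j : N) (i k : Ω),
      (M.value i j : ℝ) - p i < M.value k j - p k →
        ε ≤ M.value k j - p k - (M.value i j - p i) :=
    Filter.eventually_all.2 fun j => Filter.eventually_all.2 fun i => Filter.eventually_all.2
      fun k => by
        by_cases hi : (M.value i j : ℝ) - p i < M.value k j - p k
        · filter_upwards [hev (sub_pos.2 hi)] with ε hε _ using hε
        · exact Filter.Eventually.of_forall fun ε h => (hi h).elim
  obtain ⟨ε, hε1, hε2, hε⟩ := (h1.and (h2.and self_mem_nhdsWithin)).exists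
  refine ⟨ε, hε, fun i => ?_, hx.1, fun j => ?_⟩
  · split_ifs with hi
    · linarith [hε1 i hi]
    · linarith [hp i]
  have key : ∃ τ, M.IsThreshold (fun i => p i - (if i ∈ S then ε else 0)) j
      (fun i => x i j) τ := by
    refine exists_isThreshold_of_exchange (fun k i hk hi => ?_) (fun k hk => ?_)
      fun hlt => (hlt.ne (hfull j)).elim
    · have hle := le_of_mem_demandSet (hx.2 j) hk hi
      by_cases hiS : i ∈ S <;> by_cases hkS : k ∈ S <;>
        simp only [hiS, hkS, if_true, if_false, sub_zero]
      · linarith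
      · rcases hle.lt_or_eq with hlt | heq
        · linarith [hε2 j i k hlt]
        · exact (hkS (hclosed i hiS k ⟨j, hk, hi, heq⟩)).elim
      · linarith
      · exact hle
    · have := nonneg_of_mem_demandSet (hx.2 j) hk
      split_ifs <;> linarith
  exact key.choose_spec.mem_demandSet (hx.1.mem_bundles j)

theorem IsFeasible.sum_eq_demand {M : MultiUnitMarket Ω N} {x : Ω → N → ℕ}
    (hx : M.IsFeasible x) (hcl : M.IsMarketClearing x)
    (hlt : ∑ j, M.demand j ≤ ∑ i, M.supply i) (j : N) : ∑ i, x i j = M.demand j := by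
  unfold IsMarketClearing at hcl
  rw [min_eq_right hlt, Finset.sum_comm] at hcl
  exact (Finset.sum_eq_sum_iff_of_le fun j _ => hx.2 j).1 hcl j (Finset.mem_univ j)

/-- Buyer-optimal prices support an allocation in which only objects of price zero are not sold
out. If a unit of an object `i` with positive price is unsold, then either a path of exchanges leads
from `i` to an object of price zero, and the unsold unit is moved there, or the prices of all
objects that can be reached from `i` can be lowered. -/
theorem IsBuyerOptimal.exists_unsold_eq_zero {M : MultiUnitMarket Ω N} {p : Ω → ℝ}
    (hp : M.IsBuyerOptimal p) :
    ∃ x, M.IsStable p x ∧ M.IsMarketClearing x ∧ ∀ i, ∑ j, x i j < M.supply i → p i = 0 := by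
  classical
  obtain ⟨⟨hp0, hex⟩, hmin⟩ := hp
  rcases le_or_gt (∑ i, M.supply i) (∑ j, M.demand j) with hle | hgt
  · obtain ⟨x, hx, hcl⟩ := hex
    refine ⟨x, hx, hcl, fun i hi => ?_⟩
    unfold IsMarketClearing at hcl
    rw [min_eq_left hle] at hcl
    exact (hi.ne ((Finset.sum_eq_sum_iff_of_le fun i _ => hx.1.1 i).1 hcl i
      (Finset.mem_univ i))).elim
  -- Among the supporting allocations, take one with the fewest sold units of price zero.
  have hex' : ∃ n x, (M.IsStable p x ∧ M.IsMarketClearing x) ∧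
      ∑ i, (if p i = 0 then ∑ j, x i j else 0) = n := by
    obtain ⟨x, hx⟩ := hex
    exact ⟨_, x, hx, rfl⟩
  obtain ⟨x, ⟨hx, hcl⟩, hn⟩ := Nat.find_spec hex'
  refine ⟨x, hx, hcl, fun i hi => ?_⟩
  by_contra hpi
  by_cases hreach : ∃ k, Relation.ReflTransGen (M.CanExchange p x) i k ∧ p k = 0
  · obtain ⟨k, hik, hpk⟩ := hreach
    obtain ⟨n, c, h0, hcn, hinj, hedge⟩ := exists_simple_path hik
    obtain ⟨x', hx', hcol, hrow⟩ := hx.exists_exchange_path n c hinj (by rwa [h0]) hedge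
    rw [h0, hcn] at hrow
    refine Nat.find_min hex' (m := ∑ i, (if p i = 0 then ∑ j, x' i j else 0)) ?_
      ⟨x', ⟨hx', ?_⟩, rfl⟩
    · rw [← hn]
      refine Finset.sum_lt_sum (fun a _ => ?_) ⟨k, Finset.mem_univ k, ?_⟩
      · split_ifs with ha
        · have h1 := hrow a
          rw [if_neg (show a ≠ i by rintro rfl; exact hpi ha)] at h1
          omega
        · exact le_rfl
      · have h1 := hrow k
        rw [if_neg (show k ≠ i by rintro rfl; exact hpi hpk), if_pos rfl] at h1
        rw [if_pos hpk, if_pos hpk]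
        omega
    · unfold IsMarketClearing at hcl ⊢
      rw [← hcl, Finset.sum_comm, Finset.sum_comm (f := fun i j => x i j)]
      exact Finset.sum_congr rfl fun j _ => hcol j
  · push Not at hreach
    obtain ⟨ε, hε, hnn, hst⟩ := hx.exists_lower hp0 (hx.1.sum_eq_demand hcl hgt.le)
      (Finset.univ.filter fun k => Relation.ReflTransGen (M.CanExchange p x) i k)
      (fun k hk => (hp0 k).lt_of_ne' (hreach k (by simpa using hk)))
      (fun a ha k hak => by
        simp only [Finset.mem_filter, Finset.mem_univ, true_and] at ha ⊢
        exact ha.tail hak)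
    refine (hmin _ ⟨hnn, x, hst, hcl⟩).not_gt
      (Finset.sum_lt_sum (fun a _ => ?_) ⟨i, Finset.mem_univ i, ?_⟩)
    · split_ifs <;> linarith
    · rw [if_pos (by simpa using Relation.ReflTransGen.refl)]
      linarith

end MultiUnitMarket

theorem mainTheorem4 {Ω N : Type*} [Fintype Ω] [Fintype N]
    (v : Ω → N → ℕ) (d dNew : N → ℕ) (b bNew : Ω → ℕ)
    (hd : ∀ j, d j ≤ dNew j) (hb : ∀ i, bNew i ≤ b i)
    (p pNew : Ω → ℝ)
    (hp : (MultiUnitMarket.mk v d b).IsBuyerOptimal p)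
    (hpNew : (MultiUnitMarket.mk v dNew bNew).IsBuyerOptimal pNew) :
    ∀ i, 0 < bNew i → p i ≤ pNew i := by
  obtain ⟨x, hx, hcl, hunsold⟩ := hp.exists_unsold_eq_zero
  obtain ⟨⟨hq0, y, hy, -⟩, -⟩ := hpNew
  have hp0 := hp.1.1
  set r : Ω → ℝ := fun i => if bNew i = 0 then p i else min (p i) (pNew i) with hr
  have hr0 : ∀ i, bNew i = 0 → r i = p i := fun i h => by simp [hr, h]
  have hr1 : ∀ i, 0 < bNew i → r i = min (p i) (pNew i) := fun i h => by simp [hr, h.ne']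
  have hst := MultiUnitMarket.isStable_min hd hb hp0 hq0 hx hunsold hy hr0 hr1
  have hle : ∀ i, r i ≤ p i := fun i => by
    simp only [hr]
    split_ifs
    · exact le_rfl
    · exact min_le_left _ _
  have hnn : ∀ i, 0 ≤ r i := fun i => by
    simp only [hr]
    split_ifs
    · exact hp0 i
    · exact le_min (hp0 i) (hq0 i)
  have hsum := hp.2 r ⟨hnn, x, hst, hcl⟩
  intro i hi
  have heq := (Finset.sum_eq_sum_iff_of_le fun i _ => hle i).1
    (le_antisymm (Finset.sum_le_sum fun i _ => hle i) hsum) i (Finset.mem_univ i)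
  rw [← heq, hr1 i hi]
  exact min_le_right _ _
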